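/- Let $g\ge 1$ be an integer and let $\Sigma$ be a compact connected oriented surface of genus $g$ whose boundary is a circle $C$. For integers $k$ and $\ell$ with $1\le \ell\le k-1$, let $N^{g,k}_\ell$ be the Verlinde number, that is, the dimension of the vector space associated by $\mathrm{SU}(2)$ Chern–Simons topological quantum field theory at level $k-2$ to a genus $g$ surface with one marked point coloured by $\ell$. Concretely, $N^{g,k}_\ell$ is the number of admissible colourings of any pants decomposition of $\Sigma$: the maps assigning to each circle of the decomposition (including $C$) a colour in $\{1,\dots,k-1\}$, such that $C$ has colour $\ell$ and, for each pair of pants, the colours $a,b,c$ of its three boundary circles satisfy: $a+b+c$ is odd, $a<b+c$, $b<c+a$, $c<a+b$ and $a+b+c<2k$. **Theorem.** Let $g\ge 1$. There exist polynomials $P_{g,m}\in\mathbb{R}[x]$, $m=0,1,\dots,g-1$, depending only on $g$ and $m$, such that for every integer $k\ge 1$ and every odd integer $\ell$ with $1\le \ell\le k-1$ (and for every pants decomposition used to compute $N^{g,k}_\ell$), $$N^{g,k}_\ell=\Bigl(\frac{k}{2\pi}\Bigr)^{3g-2}\sum_{m=0}^{g-1}k^{-2m}P_{g,m}\Bigl(\frac{\ell}{k}\Bigr).$$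 Furthermore, for each $0\le m\le g-1$, $P_{g,m}$ has degree exactly $2(g-m)-1$, and its even part $\tfrac12\bigl(P_{g,m}(x)+P_{g,m}(-x)\bigr)$ equals $\lambda_{g,m}\,x^{2(g-m-1)}$ for some real number $\lambda_{g,m}$. For $m=0$, $$\lambda_{g,0}=\frac{2\,C_g\,(2\pi)^{3g-2}}{(2(g-1))!},\qquad C_g=(-1)^{g-1}2^{-g}.$$ -/

import Mathlib

/-- A pants decomposition, up to homeomorphism, of a compact connected oriented surface `Σ` of
genus `g` whose boundary is a single circle `C`.  By the Euler characteristic there are `2g - 1`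
pairs of pants.  Pair of pants `v` has the three boundary circles `(v, 0)`, `(v, 1)`, `(v, 2)`.
The involution `glue` exchanges two circles which are glued together, and its unique fixed point
is the circle `C`, which is not glued to anything. -/
structure PantsDecomposition (g : ℕ) where
  glue : Fin (2 * g - 1) × Fin 3 → Fin (2 * g - 1) × Fin 3
  glue_involutive : Function.Involutive glue
  boundary : Fin (2 * g - 1) × Fin 3
  glue_eq_self_iff : ∀ h, glue h = h ↔ h = boundary
  connected : ∀ u v : Fin (2 * g - 1),
    Relation.ReflTransGen (fun u v => ∃ i j, glue (u, i) = (v, j)) u v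

/-- The fusion rule of `SU(2)` at level `k - 2`, where a colour `a ∈ {1, …, k - 1}` is the dimension
of the corresponding irreducible representation of `SU(2)` (so `1` is the trivial colour): the
colours `a, b, c` satisfy the strict triangle inequalities, `a + b + c` is odd, and
`a + b + c < 2k`. -/
def AdmissibleTriple (k a b c : ℕ) : Prop :=
  Odd (a + b + c) ∧ a < b + c ∧ b < c + a ∧ c < a + b ∧ a + b + c < 2 * k

instance (k a b c : ℕ) : Decidable (AdmissibleTriple k a b c) := by
  unfold AdmissibleTriple; infer_instance

/-- The admissible colourings of a pants decomposition whose boundary circle has colour `ℓ`: a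
colour in `{1, …, k - 1}` for each circle, the same for circles that are glued together, such that
the three boundary circles of each pair of pants have an admissible triple of colours. -/
def admissibleColorings {g : ℕ} (D : PantsDecomposition g) (k ℓ : ℕ) :
    Finset (Fin (2 * g - 1) × Fin 3 → ℕ) :=
  (Fintype.piFinset fun _ => Finset.Icc 1 (k - 1)).filter fun c =>
    (∀ h, c (D.glue h) = c h) ∧ c D.boundary = ℓ ∧
      ∀ v, AdmissibleTriple k (c (v, 0)) (c (v, 1)) (c (v, 2))

/-- The Verlinde number `N^{g,k}_ℓ`, computed from a pants decomposition `D`. -/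
def verlindeNumber {g : ℕ} (D : PantsDecomposition g) (k ℓ : ℕ) : ℕ :=
  (admissibleColorings D k ℓ).card

/-- The even part `(p(x) + p(-x)) / 2` of a real polynomial. -/
noncomputable def evenPart (p : Polynomial ℝ) : Polynomial ℝ :=
  Polynomial.C (1 / 2) * (p + p.comp (-Polynomial.X))

/-- The constant `C_g = (-1)^{g-1} 2^{-g}` (used for `g ≥ 1`). -/
noncomputable def verlindeConst (g : ℕ) : ℝ := (-1) ^ (g - 1) / 2 ^ g

/-- The gluing map of a chain of `2g - 1` pairs of pants, the first one containing the boundary. -/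
def chainGlue (g : ℕ) (h : Fin (2 * g - 1) × Fin 3) : Fin (2 * g - 1) × Fin 3 :=
  match h with
  | (v, 0) => if hv : v.1 = 0 then (v, 0) else (⟨v.1 - 1, by omega⟩, 2)
  | (v, 1) => if hv : v.1 % 2 = 0 then
      (if hw : v.1 + 1 < 2 * g - 1 then (⟨v.1 + 1, hw⟩, 1) else (v, 2))
      else (⟨v.1 - 1, by omega⟩, 1)
  | (v, 2) => if hw : v.1 + 1 < 2 * g - 1 then (⟨v.1 + 1, hw⟩, 0) else (v, 1)

/-- Pants decompositions exist in every genus `g ≥ 1`. -/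
def chainPants (g : ℕ) (hg : 1 ≤ g) : PantsDecomposition g where
  glue := chainGlue g
  glue_involutive := by
    rintro ⟨⟨v, hv⟩, i⟩
    fin_cases i <;> simp only [chainGlue] <;> split_ifs <;> simp_all <;> grind
  boundary := (⟨0, by omega⟩, 0)
  glue_eq_self_iff := by
    rintro ⟨⟨v, hv⟩, i⟩
    fin_cases i <;> simp only [chainGlue] <;> split_ifs <;> simp_all [Prod.ext_iff, Fin.ext_iff] <;> grind
  connected := by
    have up : ∀ n (hn : n < 2 * g - 1), Relation.ReflTransGen
        (fun u v => ∃ i j, chainGlue g (u, i) = (v, j)) ⟨0, by omega⟩ ⟨n, hn⟩ := by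
      intro n
      induction n with
      | zero => intro _; exact .refl
      | succ n ih =>
        intro hn
        refine (ih (by omega)).tail ⟨2, 0, ?_⟩
        simp [chainGlue, hn]
    have down : ∀ n (hn : n < 2 * g - 1), Relation.ReflTransGen
        (fun u v => ∃ i j, chainGlue g (u, i) = (v, j)) ⟨n, hn⟩ ⟨0, by omega⟩ := by
      intro n
      induction n with
      | zero => intro _; exact .refl
      | succ n ih =>
        intro hn
        refine Relation.ReflTransGen.head ⟨0, 2, ?_⟩ (ih (by omega))
        simp [chainGlue]
    intro u v
    exact (down u.1 u.2).trans (up v.1 v.2)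

/-!
The proof starts from the Verlinde formula. The fusion rule is the truncated Clebsch–Gordan rule
(`sin_mul_sum_admissible`), so discrete Fourier inversion writes the indicator of an admissible
triple as `∑_j S_{ja} S_{jb} S_{jc} / S_{j1}` (`sum_sMatrix_triple`). Inserting this at every pair
of pants attaches an index `j` to each of them. Summing over the colour of a glued circle forces the
indices on its two sides to agree, by orthogonality of `S`; as the surface is connected, all indices
agree, whatever the decomposition. Hence (`PantsDecomposition.verlindeNumber_eq_verlindeSum`)
`N = (k / 2)^(g - 1) ∑ⱼ sin(πjℓ/k) / sin(πj/k)^(2g - 1)`.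

For odd `ℓ` with `0 < ℓ < 2k`, write `F_g(ℓ)` for the last sum. It satisfies
`F_{g+1}(ℓ + 2) - 2 F_{g+1}(ℓ) + F_{g+1}(ℓ - 2) = -4 F_g(ℓ)`, starts from `F_1(ℓ) = k - ℓ`, and is
odd about `0` and about `k`; this determines it. A polynomial solution is built in two steps. The
even central factorials `(-1)ⁿ / (2n)! · ∏_{i < n} (x² - (2i + 1)²) = ∑ᵢ αᵢ x²ⁱ`, with `n = g - 1`,
satisfy the same second difference equation and vanish at `±1` for `n ≥ 1`. With the Bernoulli
polynomials `B`, the polynomial `p(x) = -∑ᵢ αᵢ (2k)²ⁱ⁺¹ / (2i + 1) · B₂ᵢ₊₁(x / 2k)` satisfies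
`p(x + 2k) - p(x) = -2k ∑ᵢ αᵢ x²ⁱ` and is odd about `k`. Since a periodic polynomial is constant,
`p` inherits the second difference equation (`verlindePoly_second_difference`), and vanishing of the
central factorial at `±1` gives the boundary condition at `0`. So `p` agrees with `F_g`
(`verlindeSum_eq_verlindePoly`).

Each summand of `p` is homogeneous in `(k, ℓ)`, which gives `P_{g,m}` as a multiple of
`B₂ᵢ₊₁(x / 2)` with `i = g - 1 - m`. The multiple is not zero because the roots of `∑ᵢ αᵢ yⁱ` are
positive, so that its coefficients alternate in sign. The even part of `B₂ᵢ₊₁(x)` is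
`-(2i + 1) x²ⁱ / 2`, and `λ_{g,0}` is read off from the leading coefficient `αₙ`.
-/

/-! ### Discrete Fourier analysis of the fusion rule -/

/-- The sum depends on the parity of `s` only. -/
theorem sum_cos_pi_mul_div {k : ℕ} (hk : 1 ≤ k) {s : ℤ} (hs : ¬ (2 * k : ℤ) ∣ s) :
    ∑ j ∈ Finset.Icc 1 (k - 1), Real.cos (Real.pi * j * s / k) = -(1 + (-1) ^ s) / 2 := by
  have hk0 : (k : ℝ) ≠ 0 := by positivity
  have hpi := Real.pi_ne_zero
  have hrange : ∑ j ∈ Finset.range k, Real.cos (Real.pi * j * s / k)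
      = 1 + ∑ j ∈ Finset.Icc 1 (k - 1), Real.cos (Real.pi * j * s / k) := by
    rw [Finset.range_eq_Ico, Finset.sum_eq_sum_Ico_succ_bot (by omega)]
    have : Finset.Icc 1 (k - 1) = Finset.Ico (0 + 1) k := by ext; simp; omega
    simp [this]
  have hsum := Real.sum_cos k (a := Real.pi * s / k) (by
    intro m hm
    apply hs
    refine ⟨m, ?_⟩
    have : (s : ℝ) = 2 * k * m := by
      field_simp at hm
      linear_combination hm
    exact_mod_cast this) 0
  have hsin : Real.sin (Real.pi * s / k / 2) ≠ 0 := by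
    intro h0
    obtain ⟨m, hm⟩ := Real.sin_eq_zero_iff.1 h0
    apply hs
    refine ⟨m, ?_⟩
    have : (s : ℝ) = 2 * k * m := by
      field_simp at hm
      linear_combination -hm
    exact_mod_cast this
  have hprod : Real.sin (k * (Real.pi * s / k) / 2) * Real.cos ((k - 1) * (Real.pi * s / k) / 2 + 0)
      = (1 - (-1) ^ s) / 2 * Real.sin (Real.pi * s / k / 2) := by
    have h1 := Real.sin_int_mul_pi_sub (Real.pi * s / k / 2) s
    have e1 : k * (Real.pi * s / k) / 2 = s * Real.pi / 2 := by field_simp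
    have e2 : (k - 1) * (Real.pi * s / k) / 2 + 0 = s * Real.pi / 2 - Real.pi * s / k / 2 := by
      field_simp; ring
    have e3 : s * Real.pi - Real.pi * s / k / 2
      = s * Real.pi / 2 + (s * Real.pi / 2 - Real.pi * s / k / 2) := by ring
    have e4 : Real.pi * s / k / 2 = s * Real.pi / 2 - (s * Real.pi / 2 - Real.pi * s / k / 2) := by
      ring
    rw [e1, e2]
    generalize hx : s * Real.pi / 2 = x at *
    generalize hy : x - Real.pi * s / k / 2 = y at *
    rw [e3, Real.sin_add] at h1
    have h2 := Real.sin_sub x y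
    rw [← e4] at h2
    rw [h2] at h1 ⊢
    linear_combination h1 / 2
  have hsum := hsum.trans ((congrArg (· / _) hprod).trans (mul_div_cancel_right₀ _ hsin))
  have : ∑ j ∈ Finset.range k, Real.cos (Real.pi * j * s / k)
      = ∑ i ∈ Finset.range k, Real.cos (Real.pi * s / k * i + 0) :=
    Finset.sum_congr rfl fun j _ => by congr 1; ring
  rw [this, hsum] at hrange
  linear_combination -hrange

/-- Orthogonality of the discrete sine transform. -/
theorem sum_sin_mul_sin {k a b : ℕ} (ha : a ∈ Finset.Icc 1 (k - 1))
    (hb : b ∈ Finset.Icc 1 (k - 1)) :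
    ∑ j ∈ Finset.Icc 1 (k - 1), Real.sin (Real.pi * j * a / k) * Real.sin (Real.pi * j * b / k)
      = if a = b then (k : ℝ) / 2 else 0 := by
  rw [Finset.mem_Icc] at ha hb
  have hk : 1 ≤ k := by omega
  have key : ∀ j : ℕ, Real.sin (Real.pi * j * a / k) * Real.sin (Real.pi * j * b / k)
      = (Real.cos (Real.pi * j * ((a - b : ℤ) : ℤ) / k)
        - Real.cos (Real.pi * j * ((a + b : ℤ) : ℤ) / k)) / 2 := by
    intro j
    have e1 : Real.pi * j * ((a - b : ℤ) : ℤ) / k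
        = Real.pi * j * a / k - Real.pi * j * b / k := by push_cast; ring
    have e2 : Real.pi * j * ((a + b : ℤ) : ℤ) / k
        = Real.pi * j * a / k + Real.pi * j * b / k := by push_cast; ring
    rw [e1, e2, Real.cos_sub, Real.cos_add]
    ring
  have hadd : ¬ (2 * k : ℤ) ∣ (a + b : ℤ) := fun h => by
    have := Int.le_of_dvd (by omega) h
    omega
  simp_rw [key]
  rw [← Finset.sum_div, Finset.sum_sub_distrib, sum_cos_pi_mul_div hk hadd]
  split_ifs with hab
  · subst hab
    have : Even (a + a : ℤ) := ⟨a, rfl⟩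
    simp [this.neg_one_zpow, Nat.cast_sub hk]
  · have hsub : ¬ (2 * k : ℤ) ∣ (a - b : ℤ) := fun h => by
      have h1 := Int.le_of_dvd (abs_pos.2 (by omega)) ((dvd_abs _ _).2 h)
      rw [le_abs] at h1
      omega
    have hpar : ((-1 : ℝ)) ^ (a + b : ℤ) = (-1) ^ (a - b : ℤ) := by
      rw [show (a + b : ℤ) = (a - b) + 2 * b by ring, zpow_add₀ (by norm_num), zpow_mul]
      simp
    rw [sum_cos_pi_mul_div hk hsub, hpar]
    simp

theorem admissibleTriple_swap (k a b c : ℕ) :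
    AdmissibleTriple k a b c ↔ AdmissibleTriple k b a c := by
  unfold AdmissibleTriple
  rw [add_comm a b, add_comm b c, add_comm c a]
  tauto

/-- The fusion rule is the truncated Clebsch–Gordan rule: it linearizes the product of two
`SU(2)` characters at the angles `πj/k`. -/
theorem sin_mul_sum_admissible {k a b : ℕ} (ha : a ∈ Finset.Icc 1 (k - 1))
    (hb : b ∈ Finset.Icc 1 (k - 1)) (j : ℕ) :
    Real.sin (Real.pi * j / k) * ∑ c ∈ Finset.Icc 1 (k - 1) with AdmissibleTriple k a b c,
        Real.sin (Real.pi * j * c / k)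
      = Real.sin (Real.pi * j * a / k) * Real.sin (Real.pi * j * b / k) := by
  wlog hab : a ≤ b generalizing a b
  · have := this hb ha (by omega)
    simp_rw [admissibleTriple_swap k a b]
    rw [this, mul_comm]
  rw [Finset.mem_Icc] at ha hb
  have hk0 : (k : ℝ) ≠ 0 := by
    have : k ≠ 0 := by omega
    exact_mod_cast this
  -- The admissible colours are `b - a + 1, b - a + 3, …`, up to `min (a + b) (2k - a - b)`.
  obtain ⟨n, hn⟩ : ∃ n, n = min a (k - b) := ⟨_, rfl⟩
  have himage : (Finset.Icc 1 (k - 1)).filter (AdmissibleTriple k a b)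
      = (Finset.range n).image (fun i => b - a + 1 + 2 * i) := by
    ext c
    simp only [Finset.mem_filter, Finset.mem_Icc, Finset.mem_image, Finset.mem_range,
      AdmissibleTriple, Nat.odd_iff]
    constructor
    · rintro ⟨-, h⟩
      exact ⟨(c - (b - a + 1)) / 2, by omega, by omega⟩
    · rintro ⟨i, hi, rfl⟩
      omega
  rw [himage, Finset.sum_image (fun x _ y _ h => by omega)]
  have hsum := Real.sin_mul_sum_sin n (2 * (Real.pi * j / k)) ((b - a + 1) * (Real.pi * j / k))
  have e1 : 2 * (Real.pi * j / k) / 2 = Real.pi * j / k := by ring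
  have e2 : ∑ i ∈ Finset.range n, Real.sin (Real.pi * j * ((b - a + 1 + 2 * i : ℕ) : ℝ) / k)
      = ∑ i ∈ Finset.range n, Real.sin (2 * (Real.pi * j / k) * i
          + (b - a + 1) * (Real.pi * j / k)) := by
    refine Finset.sum_congr rfl fun i _ => ?_
    congr 1
    push_cast [Nat.cast_sub hab]
    ring
  rw [e1] at hsum
  rw [e2, hsum]
  have e3 : (n : ℝ) * (2 * (Real.pi * j / k)) / 2 = Real.pi * j * n / k := by ring
  have e4 : ((n : ℝ) - 1) * (2 * (Real.pi * j / k)) / 2 + (b - a + 1) * (Real.pi * j / k)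
      = Real.pi * j * (n + b - a) / k := by ring
  rw [e3, e4]
  rcases le_total a (k - b) with h | h
  · rw [min_eq_left h] at hn
    subst hn
    congr 3
    ring
  -- In the truncated case both arguments are reflected by `x ↦ πj - x`, with the same sign.
  · rw [min_eq_right h] at hn
    have hn' : (n : ℝ) = k - b := by rw [hn, Nat.cast_sub (by omega)]
    have e5 : Real.pi * j * n / k = j * Real.pi - Real.pi * j * b / k := by
      rw [hn']; field_simp
    have e6 : Real.pi * j * (n + b - a) / k = j * Real.pi - Real.pi * j * a / k := by
      rw [hn']; field_simp; ring
    rw [e5, e6, Real.sin_nat_mul_pi_sub, Real.sin_nat_mul_pi_sub]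
    have : ((-1 : ℝ) ^ j) * (-1) ^ j = 1 := by rw [← mul_pow]; simp
    linear_combination (Real.sin (Real.pi * j * a / k) * Real.sin (Real.pi * j * b / k)) * this

theorem sin_pi_mul_div_pos {k j : ℕ} (hj : j ∈ Finset.Icc 1 (k - 1)) :
    0 < Real.sin (Real.pi * j / k) := by
  rw [Finset.mem_Icc] at hj
  have hk : (0 : ℝ) < k := by
    have : 0 < k := by omega
    exact_mod_cast this
  have hjk : (j : ℝ) < k := by
    have : j < k := by omega
    exact_mod_cast this
  have hj0 : (0 : ℝ) < j := by
    have : 0 < j := by omega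
    exact_mod_cast this
  apply Real.sin_pos_of_pos_of_lt_pi (by positivity)
  rw [div_lt_iff₀ hk]
  exact mul_lt_mul_of_pos_left hjk Real.pi_pos

/-- Fourier inversion of `sin_mul_sum_admissible`. -/
theorem sum_sin_triple {k a b c : ℕ} (ha : a ∈ Finset.Icc 1 (k - 1))
    (hb : b ∈ Finset.Icc 1 (k - 1)) (hc : c ∈ Finset.Icc 1 (k - 1)) :
    ∑ j ∈ Finset.Icc 1 (k - 1), Real.sin (Real.pi * j * a / k) * Real.sin (Real.pi * j * b / k)
        * Real.sin (Real.pi * j * c / k) / Real.sin (Real.pi * j / k)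
      = if AdmissibleTriple k a b c then (k : ℝ) / 2 else 0 := by
  have key : ∀ j ∈ Finset.Icc 1 (k - 1),
      Real.sin (Real.pi * j * a / k) * Real.sin (Real.pi * j * b / k)
        * Real.sin (Real.pi * j * c / k) / Real.sin (Real.pi * j / k)
      = ∑ d ∈ Finset.Icc 1 (k - 1) with AdmissibleTriple k a b d,
          Real.sin (Real.pi * j * d / k) * Real.sin (Real.pi * j * c / k) := by
    intro j hj
    have := (sin_pi_mul_div_pos hj).ne'
    rw [← sin_mul_sum_admissible ha hb, ← Finset.sum_mul]
    field_simp
  rw [Finset.sum_congr rfl key, Finset.sum_comm,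
    Finset.sum_congr rfl fun d hd => sum_sin_mul_sin (Finset.mem_filter.1 hd).1 hc]
  simp only [Finset.sum_ite_eq', Finset.mem_filter, hc, true_and]

/-- The entries of the `S`-matrix of `SU(2)` at level `k - 2`, normalized to be orthogonal. Both
indices range over `{1, …, k - 1}`, the index `1` being the trivial colour. -/
noncomputable def sMatrix (k j a : ℕ) : ℝ :=
  √(2 / k) * Real.sin (Real.pi * j * a / k)

theorem sum_sMatrix_mul_sMatrix {k i j : ℕ} (hi : i ∈ Finset.Icc 1 (k - 1))
    (hj : j ∈ Finset.Icc 1 (k - 1)) :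
    ∑ a ∈ Finset.Icc 1 (k - 1), sMatrix k i a * sMatrix k j a = if i = j then 1 else 0 := by
  have hk : (k : ℝ) ≠ 0 := by
    rw [Finset.mem_Icc] at hi
    have : k ≠ 0 := by omega
    exact_mod_cast this
  have hsq : √(2 / (k : ℝ)) * √(2 / k) = 2 / k := Real.mul_self_sqrt (by positivity)
  have : ∀ a ∈ Finset.Icc 1 (k - 1), sMatrix k i a * sMatrix k j a
      = 2 / k * (Real.sin (Real.pi * a * i / k) * Real.sin (Real.pi * a * j / k)) := by
    intro a _
    rw [← hsq, sMatrix, sMatrix, mul_right_comm Real.pi (i : ℝ), mul_right_comm Real.pi (j : ℝ)]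
    ring
  rw [Finset.sum_congr rfl this, ← Finset.mul_sum, sum_sin_mul_sin hi hj]
  split_ifs
  · field_simp
  · exact mul_zero _

/-- The Verlinde formula for a pair of pants, in terms of the `S`-matrix. -/
theorem sum_sMatrix_triple {k a b c : ℕ} (ha : a ∈ Finset.Icc 1 (k - 1))
    (hb : b ∈ Finset.Icc 1 (k - 1)) (hc : c ∈ Finset.Icc 1 (k - 1)) :
    ∑ j ∈ Finset.Icc 1 (k - 1), (sMatrix k j 1)⁻¹ * (sMatrix k j a * sMatrix k j b * sMatrix k j c)
      = if AdmissibleTriple k a b c then 1 else 0 := by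
  have hk : 0 < k := by
    rw [Finset.mem_Icc] at ha
    omega
  have hk' : (k : ℝ) ≠ 0 := by positivity
  have hsq : √(2 / (k : ℝ)) * √(2 / k) = 2 / k := Real.mul_self_sqrt (by positivity)
  have hpos : √(2 / (k : ℝ)) ≠ 0 := by positivity
  have : ∀ j ∈ Finset.Icc 1 (k - 1),
      (sMatrix k j 1)⁻¹ * (sMatrix k j a * sMatrix k j b * sMatrix k j c)
      = 2 / k * (Real.sin (Real.pi * j * a / k) * Real.sin (Real.pi * j * b / k)
        * Real.sin (Real.pi * j * c / k) / Real.sin (Real.pi * j / k)) := by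
    intro j hj
    have := (sin_pi_mul_div_pos hj).ne'
    rw [← hsq]
    simp only [sMatrix, Nat.cast_one, mul_one]
    field_simp
  rw [Finset.sum_congr rfl this, ← Finset.mul_sum, sum_sin_triple ha hb hc]
  split_ifs
  · field_simp
  · exact mul_zero _

/-! ### The state sum of a pants decomposition -/

namespace PantsDecomposition

variable {g : ℕ} (D : PantsDecomposition g)

/-- Two boundary circles of pairs of pants are related if they are the same circle of `Σ`. -/
def circleSetoid : Setoid (Fin (2 * g - 1) × Fin 3) where
  r h h' := h' = h ∨ h' = D.glue h
  iseqv :=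
    { refl := fun _ => .inl rfl
      symm := by
        rintro h _ (rfl | rfl)
        · exact .inl rfl
        · exact .inr (D.glue_involutive h).symm
      trans := by
        rintro h _ _ (rfl | rfl) (rfl | rfl)
        · exact .inl rfl
        · exact .inr rfl
        · exact .inr rfl
        · exact .inl (D.glue_involutive h) }

/-- The circles of the pants decomposition, including the boundary of `Σ`. -/
abbrev Circle : Type := Quotient D.circleSetoid

/-- The circle of `Σ` on which a boundary circle of a pair of pants lies. -/
def toCircle (h : Fin (2 * g - 1) × Fin 3) : D.Circle := Quotient.mk D.circleSetoid h

theorem toCircle_surjective : Function.Surjective D.toCircle := Quotient.mk_surjective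

theorem toCircle_eq_iff {h h' : Fin (2 * g - 1) × Fin 3} :
    D.toCircle h = D.toCircle h' ↔ h' = h ∨ h' = D.glue h :=
  Quotient.eq

theorem toCircle_glue (h : Fin (2 * g - 1) × Fin 3) : D.toCircle (D.glue h) = D.toCircle h :=
  (D.toCircle_eq_iff.2 (.inr rfl)).symm

open Classical in
theorem filter_toCircle_eq (h : Fin (2 * g - 1) × Fin 3) :
    (Finset.univ.filter fun h' => D.toCircle h' = D.toCircle h) = {h, D.glue h} := by
  ext h'
  rw [Finset.mem_filter, eq_comm, D.toCircle_eq_iff]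
  simp

theorem glue_boundary : D.glue D.boundary = D.boundary := (D.glue_eq_self_iff _).2 rfl

/-- The labellings of the boundary circles of the pairs of pants which come from a labelling of the
circles of `Σ` with values in `{1, …, k - 1}` that sends the boundary of `Σ` to `ℓ`. -/
def gluedLabelings (k ℓ : ℕ) : Finset (Fin (2 * g - 1) × Fin 3 → ℕ) :=
  (Fintype.piFinset fun _ => Finset.Icc 1 (k - 1)).filter fun c =>
    (∀ h, c (D.glue h) = c h) ∧ c D.boundary = ℓ

open Classical in
/-- A sum over glued labellings of a product of local weights factors over the circles of `Σ`. -/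
theorem sum_gluedLabelings {k ℓ : ℕ} (hℓ : ℓ ∈ Finset.Icc 1 (k - 1))
    (F : Fin (2 * g - 1) × Fin 3 → ℕ → ℝ) :
    ∑ c ∈ D.gluedLabelings k ℓ, ∏ h, F h (c h)
      = ∏ r : D.Circle, ∑ x ∈ if r = D.toCircle D.boundary then {ℓ} else Finset.Icc 1 (k - 1),
          ∏ h with D.toCircle h = r, F h x := by
  have himage : D.gluedLabelings k ℓ = (Fintype.piFinset fun r : D.Circle =>
      if r = D.toCircle D.boundary then {ℓ} else Finset.Icc 1 (k - 1)).image
        (fun d => d ∘ D.toCircle) := by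
    ext c
    simp only [gluedLabelings, Finset.mem_filter, Fintype.mem_piFinset, Finset.mem_image]
    constructor
    · rintro ⟨hc, hglue, hb⟩
      refine ⟨Quotient.lift c ?_, ?_, rfl⟩
      · rintro h _ (rfl | rfl)
        · rfl
        · exact (hglue h).symm
      · intro r
        obtain ⟨h, rfl⟩ := D.toCircle_surjective r
        split_ifs with hr
        · rw [eq_comm, D.toCircle_eq_iff, D.glue_boundary, or_self] at hr
          rw [hr]
          exact Finset.mem_singleton.2 hb
        · exact hc h
    · rintro ⟨d, hd, rfl⟩
      refine ⟨fun h => ?_, fun h => ?_, ?_⟩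
      · have := hd (D.toCircle h)
        split_ifs at this
        · rw [Finset.mem_singleton] at this
          rwa [Function.comp_apply, this]
        · exact this
      · rw [Function.comp_apply, D.toCircle_glue, Function.comp_apply]
      · simpa using hd (D.toCircle D.boundary)
  rw [himage, Finset.sum_image, Finset.prod_univ_sum]
  · refine Finset.sum_congr rfl fun d _ => ?_
    rw [← Finset.prod_fiberwise Finset.univ D.toCircle]
    refine Finset.prod_congr rfl fun r _ => Finset.prod_congr rfl fun h hh => ?_
    rw [Function.comp_apply, (Finset.mem_filter.1 hh).2]
  · intro d _ d' _ h
    exact D.toCircle_surjective.injective_comp_right h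

/-- Summing over the labels of the glued circles forces the indices of adjacent, hence of all,
pairs of pants to coincide, by orthogonality of the `S`-matrix. -/
theorem sum_gluedLabelings_sMatrix {k ℓ : ℕ} (hℓ : ℓ ∈ Finset.Icc 1 (k - 1))
    {J : Fin (2 * g - 1) → ℕ} (hJ : ∀ v, J v ∈ Finset.Icc 1 (k - 1)) :
    ∑ c ∈ D.gluedLabelings k ℓ, ∏ h, sMatrix k (J h.1) (c h)
      = if ∀ v, J v = J D.boundary.1 then sMatrix k (J D.boundary.1) ℓ else 0 := by
  classical
  rw [D.sum_gluedLabelings hℓ fun h x => sMatrix k (J h.1) x]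
  have hglued : ∀ h, h ≠ D.boundary →
      (∑ x ∈ if D.toCircle h = D.toCircle D.boundary then {ℓ} else Finset.Icc 1 (k - 1),
          ∏ h' with D.toCircle h' = D.toCircle h, sMatrix k (J h'.1) x)
        = if J h.1 = J (D.glue h).1 then 1 else 0 := by
    intro h hh
    have hne : ¬ D.toCircle h = D.toCircle D.boundary := by
      rw [eq_comm, D.toCircle_eq_iff, D.glue_boundary, or_self]
      exact hh
    rw [if_neg hne, D.filter_toCircle_eq, ← sum_sMatrix_mul_sMatrix (hJ _) (hJ _)]
    refine Finset.sum_congr rfl fun x _ => Finset.prod_pair fun h' => hh ?_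
    exact (D.glue_eq_self_iff h).1 h'.symm
  split_ifs with hconst
  · rw [Finset.prod_eq_single (D.toCircle D.boundary)]
    · rw [if_pos rfl, D.filter_toCircle_eq, D.glue_boundary]
      simp
    · intro r _ hr
      obtain ⟨h, rfl⟩ := D.toCircle_surjective r
      rw [hglued h (fun hh => hr (by rw [hh])), if_pos]
      rw [hconst, hconst (D.glue h).1]
    · simp
  · obtain ⟨h, hh⟩ : ∃ h, J h.1 ≠ J (D.glue h).1 := by
      by_contra! hall
      apply hconst
      intro v
      induction D.connected v D.boundary.1 using Relation.ReflTransGen.head_induction_on with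
      | refl => rfl
      | head h _ ih =>
        obtain ⟨i, j, hij⟩ := h
        rw [← ih, hall (_, i), hij]
    refine Finset.prod_eq_zero (Finset.mem_univ (D.toCircle h)) ?_
    rw [hglued h, if_neg hh]
    rintro rfl
    exact hh (by rw [D.glue_boundary])

/-- The Verlinde formula: the number of colourings does not depend on the pants decomposition. -/
theorem verlindeNumber_eq_sum {k ℓ : ℕ} (hℓ : ℓ ∈ Finset.Icc 1 (k - 1)) :
    (verlindeNumber D k ℓ : ℝ)
      = ∑ j ∈ Finset.Icc 1 (k - 1), (sMatrix k j 1)⁻¹ ^ (2 * g - 1) * sMatrix k j ℓ := by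
  classical
  have hfilter : admissibleColorings D k ℓ = (D.gluedLabelings k ℓ).filter fun c =>
      ∀ v, AdmissibleTriple k (c (v, 0)) (c (v, 1)) (c (v, 2)) := by
    ext c
    simp only [admissibleColorings, gluedLabelings, Finset.mem_filter]
    tauto
  have hterm : ∀ c ∈ D.gluedLabelings k ℓ,
      (if ∀ v, AdmissibleTriple k (c (v, 0)) (c (v, 1)) (c (v, 2)) then (1 : ℝ) else 0)
        = ∑ J ∈ Fintype.piFinset fun _ : Fin (2 * g - 1) => Finset.Icc 1 (k - 1),
            (∏ v, (sMatrix k (J v) 1)⁻¹) * ∏ h, sMatrix k (J h.1) (c h) := by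
    -- Choosing a summand of the formula for each pair of pants amounts to an indexing `J`.
    intro c hc
    have hc' := fun h => Fintype.mem_piFinset.1 (Finset.mem_filter.1 hc).1 h
    have hprod : (if ∀ v, AdmissibleTriple k (c (v, 0)) (c (v, 1)) (c (v, 2)) then (1 : ℝ) else 0)
        = ∏ v, if AdmissibleTriple k (c (v, 0)) (c (v, 1)) (c (v, 2)) then (1 : ℝ) else 0 := by
      rw [Fintype.prod_ite_zero, Finset.prod_const_one]
      congr
    rw [hprod, Finset.prod_congr rfl fun v _ =>
      (sum_sMatrix_triple (hc' (v, 0)) (hc' (v, 1)) (hc' (v, 2))).symm, Finset.prod_univ_sum]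
    refine Finset.sum_congr rfl fun J _ => ?_
    rw [Finset.prod_mul_distrib, Fintype.prod_prod_type]
    simp only [Fin.prod_univ_three]
  rw [verlindeNumber, hfilter, Finset.card_filter]
  push_cast
  rw [Finset.sum_congr rfl hterm, Finset.sum_comm]
  have hinner : ∀ J ∈ Fintype.piFinset fun _ : Fin (2 * g - 1) => Finset.Icc 1 (k - 1),
      ∑ c ∈ D.gluedLabelings k ℓ,
        (∏ v, (sMatrix k (J v) 1)⁻¹) * ∏ h, sMatrix k (J h.1) (c h)
      = if ∀ v, J v = J D.boundary.1 then
          (sMatrix k (J D.boundary.1) 1)⁻¹ ^ (2 * g - 1) * sMatrix k (J D.boundary.1) ℓ else 0 := by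
    intro J hJ
    rw [← Finset.mul_sum, D.sum_gluedLabelings_sMatrix hℓ (Fintype.mem_piFinset.1 hJ)]
    split_ifs with hconst
    · rw [Finset.prod_congr rfl fun v _ => by rw [hconst v]]
      simp
    · simp
  rw [Finset.sum_congr rfl hinner, ← Finset.sum_filter]
  refine Finset.sum_bij' (fun J _ => J D.boundary.1) (fun j _ _ => j) ?_ ?_ ?_ ?_ ?_
  · intro J hJ
    exact Fintype.mem_piFinset.1 (Finset.mem_filter.1 hJ).1 _
  · intro j hj
    simpa using fun _ => Finset.mem_Icc.1 hj
  · intro J hJ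
    exact funext fun v => ((Finset.mem_filter.1 hJ).2 v).symm
  · intro j _
    rfl
  · intro J _
    rfl

end PantsDecomposition

/-! ### Central factorials -/

open Polynomial in
/-- The polynomial `aₙ` with `aₙ(x²) = (-1)ⁿ / (2n)! · ∏_{i < n} (x² - (2i + 1)²)`, an even central
factorial with step `2`. -/
noncomputable def centralFactorial (n : ℕ) : Polynomial ℝ :=
  C ((-1) ^ n / ((2 * n).factorial : ℝ)) *
    ∏ i ∈ Finset.range n, (X - C ((2 * i + 1 : ℝ) ^ 2))

theorem centralFactorial_eval (n : ℕ) (y : ℝ) :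
    (centralFactorial n).eval y = (-1) ^ n / ((2 * n).factorial : ℝ) *
      ∏ i ∈ Finset.range n, (y - (2 * i + 1 : ℝ) ^ 2) := by
  simp [centralFactorial, Polynomial.eval_prod]

theorem prod_sub_odd_sq_shift (n : ℕ) (x : ℝ) :
    ∏ i ∈ Finset.range (n + 1), ((x + 2) ^ 2 - (2 * i + 1 : ℝ) ^ 2)
      = (x + (2 * n + 1)) * (x + (2 * n + 3)) *
        ∏ i ∈ Finset.range n, (x ^ 2 - (2 * i + 1 : ℝ) ^ 2) := by
  induction n with
  | zero => simp; ring
  | succ n ih =>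
    rw [Finset.prod_range_succ, ih, Finset.prod_range_succ]
    push_cast
    ring

/-- The second difference with step `2` lowers the index of the central factorial. -/
theorem centralFactorial_second_difference (n : ℕ) (x : ℝ) :
    (centralFactorial (n + 1)).eval ((x + 2) ^ 2) - 2 * (centralFactorial (n + 1)).eval (x ^ 2)
      + (centralFactorial (n + 1)).eval ((x - 2) ^ 2) = -4 * (centralFactorial n).eval (x ^ 2) := by
  simp only [centralFactorial_eval]
  have h1 := prod_sub_odd_sq_shift n x
  have h2 := prod_sub_odd_sq_shift n (-x)
  rw [neg_sq, show (-x + 2) ^ 2 = (x - 2) ^ 2 by ring] at h2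
  rw [h1, h2, Finset.prod_range_succ, pow_succ, show 2 * (n + 1) = 2 * n + 1 + 1 by ring,
    Nat.factorial_succ, Nat.factorial_succ]
  push_cast
  have : ((2 * n).factorial : ℝ) ≠ 0 := by exact_mod_cast Nat.factorial_ne_zero _
  field_simp
  ring

theorem centralFactorial_succ_eval_one (n : ℕ) : (centralFactorial (n + 1)).eval 1 = 0 := by
  rw [centralFactorial_eval, Finset.prod_range_succ']
  simp

theorem centralFactorial_natDegree_le (n : ℕ) : (centralFactorial n).natDegree ≤ n := by
  refine (Polynomial.natDegree_C_mul_le _ _).trans ?_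
  rw [Polynomial.natDegree_finsetProd_X_sub_C_eq_card, Finset.card_range]

theorem centralFactorial_eval_eq_sum (n : ℕ) (y : ℝ) :
    (centralFactorial n).eval y
      = ∑ i ∈ Finset.range (n + 1), (centralFactorial n).coeff i * y ^ i :=
  Polynomial.eval_eq_sum_range' (Nat.lt_succ_of_le (centralFactorial_natDegree_le n)) y

theorem centralFactorial_coeff_self (n : ℕ) :
    (centralFactorial n).coeff n = (-1) ^ n / ((2 * n).factorial : ℝ) := by
  have hm := Polynomial.monic_prod_of_monic (Finset.range n)
    (fun i : ℕ => Polynomial.X - Polynomial.C ((2 * i + 1 : ℝ) ^ 2))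
    fun i _ => Polynomial.monic_X_sub_C _
  have hd := Polynomial.natDegree_finsetProd_X_sub_C_eq_card (Finset.range n)
    fun i : ℕ => (2 * i + 1 : ℝ) ^ 2
  have := hm.coeff_natDegree
  rw [hd, Finset.card_range] at this
  rw [centralFactorial, Polynomial.coeff_C_mul, this, mul_one]

/-- A monic polynomial all of whose roots are positive has coefficients of alternating sign. -/
theorem coeff_prod_X_sub_C_sign {c : ℕ → ℝ} (hc : ∀ i, 0 < c i) (n : ℕ) :
    ∀ j ≤ n, 0 < (-1) ^ (n + j) *
      (∏ i ∈ Finset.range n, (Polynomial.X - Polynomial.C (c i))).coeff j := by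
  induction n with
  | zero => simp
  | succ n ih =>
    intro j hj
    rw [Finset.prod_range_succ]
    generalize hq : ∏ i ∈ Finset.range n, (Polynomial.X - Polynomial.C (c i)) = q at ih ⊢
    have hdeg : q.natDegree = n := by
      rw [← hq, Polynomial.natDegree_finsetProd_X_sub_C_eq_card, Finset.card_range]
    have hlow : j ≤ n → 0 < (-1) ^ (n + j) * q.coeff j * c n :=
      fun h => mul_pos (ih j h) (hc n)
    have hlow' : 0 ≤ (-1) ^ (n + j) * q.coeff j * c n := by
      rcases hj.lt_or_eq with h | rfl
      · exact (hlow (by omega)).le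
      · rw [Polynomial.coeff_eq_zero_of_natDegree_lt (by omega)]
        simp
    cases j with
    | zero =>
      have := hlow (by omega)
      rw [mul_sub, Polynomial.coeff_sub, Polynomial.coeff_mul_X_zero, Polynomial.coeff_mul_C]
      rw [add_zero] at this ⊢
      rw [pow_succ]
      linarith
    | succ j =>
      have := ih j (by omega)
      rw [mul_sub, Polynomial.coeff_sub, Polynomial.coeff_mul_X, Polynomial.coeff_mul_C]
      rw [show n + 1 + (j + 1) = n + (j + 1) + 1 by ring, pow_succ]
      rw [show n + (j + 1) = n + j + 1 by ring, pow_succ] at hlow' ⊢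
      linarith

theorem centralFactorial_coeff_ne_zero {n i : ℕ} (hi : i ≤ n) :
    (centralFactorial n).coeff i ≠ 0 := by
  have h := coeff_prod_X_sub_C_sign (c := fun i : ℕ => (2 * i + 1 : ℝ) ^ 2)
    (fun i => by positivity) n i hi
  rw [centralFactorial, Polynomial.coeff_C_mul]
  refine mul_ne_zero (div_ne_zero (by simp) (by exact_mod_cast Nat.factorial_ne_zero _)) ?_
  exact right_ne_zero_of_mul h.ne'

/-! ### Inverting the difference operator with Bernoulli polynomials -/

theorem bernoulliFun_one_add (n : ℕ) (x : ℝ) :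
    bernoulliFun n (1 + x) = bernoulliFun n x + n * x ^ (n - 1) := by
  simpa [bernoulliFun, Polynomial.aeval_comp]
    using congr_arg (·.aeval x) (Polynomial.bernoulli_comp_one_add_X n)

/-- The polynomial in `x` obtained from `-2k ∑ᵢ αᵢ x²ⁱ`, where the `αᵢ` are the coefficients of the
central factorial, by inverting the difference operator `p(x) ↦ p(x + 2k) - p(x)` with the help of
Bernoulli polynomials. -/
noncomputable def verlindePoly (n k : ℕ) : Polynomial ℝ :=
  -∑ i ∈ Finset.range (n + 1),
    Polynomial.C ((centralFactorial n).coeff i * (2 * k) ^ (2 * i + 1) / (2 * i + 1)) *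
      ((Polynomial.bernoulli (2 * i + 1)).map (algebraMap ℚ ℝ)).comp
        (Polynomial.C (2 * k : ℝ)⁻¹ * Polynomial.X)

theorem verlindePoly_eval (n k : ℕ) (x : ℝ) :
    (verlindePoly n k).eval x = -∑ i ∈ Finset.range (n + 1),
      (centralFactorial n).coeff i * (2 * k) ^ (2 * i + 1) / (2 * i + 1)
        * bernoulliFun (2 * i + 1) (x / (2 * k)) := by
  rw [verlindePoly, Polynomial.eval_neg, Polynomial.eval_finsetSum]
  congr 1
  refine Finset.sum_congr rfl fun i _ => ?_
  rw [Polynomial.eval_mul, Polynomial.eval_C, Polynomial.eval_comp, bernoulliFun,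
    Polynomial.eval_mul, Polynomial.eval_C, Polynomial.eval_X, inv_mul_eq_div]

theorem verlindePoly_eval_add {n k : ℕ} (hk : 0 < k) (x : ℝ) :
    (verlindePoly n k).eval (x + 2 * k)
      = (verlindePoly n k).eval x - 2 * k * (centralFactorial n).eval (x ^ 2) := by
  have hk' : (k : ℝ) ≠ 0 := by positivity
  rw [verlindePoly_eval, verlindePoly_eval, centralFactorial_eval_eq_sum, Finset.mul_sum,
    ← neg_add', ← Finset.sum_add_distrib]
  congr 1
  refine Finset.sum_congr rfl fun i _ => ?_
  rw [show (x + 2 * k) / (2 * k) = 1 + x / (2 * k) by field_simp; ring, bernoulliFun_one_add,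
    Nat.add_sub_cancel, div_pow, pow_succ, ← pow_mul]
  have : (2 * (i : ℝ) + 1) ≠ 0 := by positivity
  push_cast
  field_simp

theorem verlindePoly_eval_sub {n k : ℕ} (hk : 0 < k) (x : ℝ) :
    (verlindePoly n k).eval (2 * k - x) = -(verlindePoly n k).eval x := by
  have hk' : (k : ℝ) ≠ 0 := by positivity
  rw [verlindePoly_eval, verlindePoly_eval, neg_inj, ← Finset.sum_neg_distrib]
  refine Finset.sum_congr rfl fun i _ => ?_
  rw [show (2 * k - x) / (2 * k) = 1 - x / (2 * k) by field_simp, bernoulliFun_eval_one_sub,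
    (odd_two_mul_add_one i).neg_one_pow]
  ring

/-- A periodic polynomial is constant, hence zero if it is odd about half a period. -/
theorem Polynomial.eq_zero_of_periodic_of_odd {Q : Polynomial ℝ} {c : ℝ} (hc : c ≠ 0)
    (hper : ∀ x, Q.eval (x + c) = Q.eval x) (hodd : ∀ x, Q.eval (c - x) = -Q.eval x) : Q = 0 := by
  have hmul : ∀ m : ℕ, Q.eval (m * c) = Q.eval 0 := by
    intro m
    induction m with
    | zero => simp
    | succ m ih => rw [← ih, ← hper (m * c)]; congr 1; push_cast; ring
  have hconst : Q = Polynomial.C (Q.eval 0) := by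
    refine Polynomial.eq_of_infinite_eval_eq _ _ ?_
    refine Set.infinite_of_injective_forall_mem (f := fun m : ℕ => (m : ℝ) * c) ?_ ?_
    · intro m m' h
      exact_mod_cast mul_right_cancel₀ hc h
    · intro m
      simp [hmul m]
  have h0 := hodd 0
  have h1 := hper 0
  rw [zero_add] at h1
  rw [sub_zero, h1] at h0
  rw [hconst, show Q.eval 0 = 0 by linarith, Polynomial.C_0]

theorem verlindePoly_second_difference {n k : ℕ} (hk : 0 < k) (x : ℝ) :
    (verlindePoly (n + 1) k).eval (x + 2) - 2 * (verlindePoly (n + 1) k).eval x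
      + (verlindePoly (n + 1) k).eval (x - 2) = -4 * (verlindePoly n k).eval x := by
  -- The defect `Q` of the equation is periodic and odd about `k`.
  obtain ⟨Q, hQ⟩ : ∃ Q : Polynomial ℝ, ∀ x, Q.eval x = (verlindePoly (n + 1) k).eval (x + 2)
      - 2 * (verlindePoly (n + 1) k).eval x + (verlindePoly (n + 1) k).eval (x - 2)
      + 4 * (verlindePoly n k).eval x :=
    ⟨(verlindePoly (n + 1) k).comp (Polynomial.X + Polynomial.C 2)
      - Polynomial.C 2 * verlindePoly (n + 1) k
      + (verlindePoly (n + 1) k).comp (Polynomial.X - Polynomial.C 2)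
      + Polynomial.C 4 * verlindePoly n k, fun x => by simp⟩
  have hQ0 : Q = 0 := by
    refine Polynomial.eq_zero_of_periodic_of_odd (c := 2 * k) (by positivity) ?_ ?_
    · intro x
      rw [hQ, hQ, show x + 2 * (k : ℝ) + 2 = x + 2 + 2 * k by ring,
        show x + 2 * (k : ℝ) - 2 = x - 2 + 2 * k by ring]
      simp only [verlindePoly_eval_add hk]
      linear_combination (-2 * (k : ℝ)) * centralFactorial_second_difference n x
    · intro x
      rw [hQ, hQ, show 2 * (k : ℝ) - x + 2 = 2 * k - (x - 2) by ring,
        show 2 * (k : ℝ) - x - 2 = 2 * k - (x + 2) by ring]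
      simp only [verlindePoly_eval_sub hk]
      ring
  have := hQ x
  rw [hQ0, Polynomial.eval_zero] at this
  linarith

theorem verlindePoly_succ_eval_neg_one {n k : ℕ} (hk : 0 < k) :
    (verlindePoly (n + 1) k).eval (-1) = -(verlindePoly (n + 1) k).eval 1 := by
  have h1 := verlindePoly_eval_add (n := n + 1) hk (-1)
  have h2 := verlindePoly_eval_sub (n := n + 1) hk 1
  rw [neg_one_sq, centralFactorial_succ_eval_one, neg_add_eq_sub, h2] at h1
  linarith

/-! ### The trigonometric sum -/

/-- The trigonometric sum of the Verlinde formula in genus `n + 1`. -/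
noncomputable def verlindeSum (n k : ℕ) (x : ℝ) : ℝ :=
  ∑ j ∈ Finset.Icc 1 (k - 1),
    Real.sin (Real.pi * j * x / k) / Real.sin (Real.pi * j / k) ^ (2 * n + 1)

theorem verlindeSum_neg (n k : ℕ) (x : ℝ) : verlindeSum n k (-x) = -verlindeSum n k x := by
  simp [verlindeSum, neg_div]

theorem verlindeSum_sub {n k : ℕ} (hk : 0 < k) (x : ℝ) :
    verlindeSum n k (2 * k - x) = -verlindeSum n k x := by
  have hk' : (k : ℝ) ≠ 0 := by positivity
  rw [verlindeSum, verlindeSum, ← Finset.sum_neg_distrib]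
  refine Finset.sum_congr rfl fun j _ => ?_
  rw [show Real.pi * j * (2 * k - x) / k = j * (2 * Real.pi) - Real.pi * j * x / k by
    field_simp, Real.sin_nat_mul_two_pi_sub, neg_div]

theorem verlindeSum_second_difference (n k : ℕ) (x : ℝ) :
    verlindeSum (n + 1) k (x + 2) - 2 * verlindeSum (n + 1) k x + verlindeSum (n + 1) k (x - 2)
      = -4 * verlindeSum n k x := by
  simp only [verlindeSum]
  rw [Finset.mul_sum, Finset.mul_sum, ← Finset.sum_sub_distrib, ← Finset.sum_add_distrib]
  refine Finset.sum_congr rfl fun j hj => ?_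
  have hs := (sin_pi_mul_div_pos hj).ne'
  have e1 : Real.pi * j * (x + 2) / k = Real.pi * j * x / k + 2 * (Real.pi * j / k) := by ring
  have e2 : Real.pi * j * (x - 2) / k = Real.pi * j * x / k - 2 * (Real.pi * j / k) := by ring
  rw [e1, e2, Real.sin_add, Real.sin_sub, Real.cos_two_mul', Real.cos_sq']
  rw [show 2 * (n + 1) + 1 = 2 * n + 1 + 2 by ring, pow_add]
  field_simp
  ring

theorem verlindeSum_zero {k t : ℕ} (ht : t < k) :
    verlindeSum 0 k (2 * t + 1) = k - (2 * t + 1) := by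
  induction t with
  | zero =>
    have : ∀ j ∈ Finset.Icc 1 (k - 1), Real.sin (Real.pi * j * (2 * (0 : ℕ) + 1) / k)
        / Real.sin (Real.pi * j / k) ^ (2 * 0 + 1) = 1 := by
      intro j hj
      have hs := (sin_pi_mul_div_pos hj).ne'
      simpa using div_self hs
    rw [verlindeSum, Finset.sum_congr rfl this]
    simp [Nat.cast_sub (show 1 ≤ k by omega)]
  | succ t ih =>
    have hstep : verlindeSum 0 k (2 * (t + 1 : ℕ) + 1) - verlindeSum 0 k (2 * t + 1)
        = 2 * ∑ j ∈ Finset.Icc 1 (k - 1), Real.cos (Real.pi * j * (2 * t + 2 : ℤ) / k) := by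
      rw [verlindeSum, verlindeSum, Finset.mul_sum, ← Finset.sum_sub_distrib]
      refine Finset.sum_congr rfl fun j hj => ?_
      have hs := (sin_pi_mul_div_pos hj).ne'
      rw [← sub_div, Real.sin_sub_sin, mul_zero, zero_add, pow_one, div_eq_iff hs]
      push_cast
      rw [show (Real.pi * j * (2 * (t + 1) + 1) / k - Real.pi * j * (2 * t + 1) / k) / 2
        = Real.pi * j / k by ring,
        show (Real.pi * j * (2 * (t + 1) + 1) / k + Real.pi * j * (2 * t + 1) / k) / 2
        = Real.pi * j * (2 * t + 2) / k by ring]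
      ring
    have hdvd : ¬ (2 * k : ℤ) ∣ (2 * t + 2 : ℤ) := fun h => by
      have := Int.le_of_dvd (by omega) h
      omega
    have hsum := sum_cos_pi_mul_div (show 1 ≤ k by omega) hdvd
    have heven : Even (2 * t + 2 : ℤ) := ⟨t + 1, by ring⟩
    rw [heven.neg_one_zpow] at hsum
    push_cast at hstep hsum ⊢
    rw [hsum, ih (by omega)] at hstep
    linarith

/-- The trigonometric sum is polynomial at odd integers: both sides satisfy the same second
difference equation with the same antisymmetries, so their difference is an affine function which
vanishes. -/
theorem verlindeSum_eq_verlindePoly {k : ℕ} (n : ℕ) {t : ℕ} (ht : t < k) :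
    verlindeSum n k (2 * t + 1) = (verlindePoly n k).eval (2 * t + 1 : ℝ) := by
  have hk : 0 < k := by omega
  induction n generalizing t with
  | zero =>
    have hk' : (k : ℝ) ≠ 0 := by positivity
    rw [verlindeSum_zero ht, verlindePoly_eval]
    -- `B₁(x) = x - 1 / 2`
    simp [centralFactorial]
    field_simp
    ring
  | succ n ih =>
    -- `e s` is the defect at the odd integer `2s - 1`, for `-1 ≤ 2s - 1 ≤ 2k + 1`.
    obtain ⟨e, he⟩ : ∃ e : ℕ → ℝ, ∀ s : ℕ, e s = verlindeSum (n + 1) k (2 * s - 1)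
      - (verlindePoly (n + 1) k).eval (2 * s - 1 : ℝ) := ⟨_, fun _ => rfl⟩
    have hrec : ∀ s < k, e (s + 2) - 2 * e (s + 1) + e s = 0 := by
      intro s hs
      have h1 := verlindeSum_second_difference n k (2 * s + 1)
      have h2 := verlindePoly_second_difference (n := n) hk (2 * s + 1)
      rw [ih hs, ← h2] at h1
      simp only [he]
      push_cast
      rw [show (2 * ((s : ℝ) + 2) - 1) = 2 * s + 1 + 2 by ring,
        show (2 * ((s : ℝ) + 1) - 1) = 2 * s + 1 by ring,
        show (2 * (s : ℝ) - 1) = 2 * s + 1 - 2 by ring]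
      linarith
    have haff : ∀ s, s ≤ k → e s = e 0 + s * (e 1 - e 0) ∧
        e (s + 1) = e 0 + (s + 1) * (e 1 - e 0) := by
      intro s
      induction s with
      | zero => intro _; simp
      | succ s ihs =>
        intro hs
        obtain ⟨h1, h2⟩ := ihs (by omega)
        refine ⟨by push_cast; exact h2, ?_⟩
        have := hrec s (by omega)
        push_cast
        linarith
    -- Antisymmetry about `0`, and then about `k`.
    have h10 : e 0 = -e 1 := by
      rw [he, he]
      have := verlindeSum_neg (n + 1) k 1
      have := verlindePoly_succ_eval_neg_one (n := n) hk
      norm_num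
      linarith
    have hlast : e (k + 1) = -e 0 := by
      rw [he, he]
      have h1 := verlindeSum_sub (n := n + 1) hk (-1)
      have h2 := verlindePoly_eval_sub (n := n + 1) hk (-1)
      push_cast
      rw [show 2 * ((k : ℝ) + 1) - 1 = 2 * k - -1 by ring, h1, h2, mul_zero, zero_sub]
      ring
    have h0 : e 0 = 0 := by
      have h := (haff k le_rfl).2
      rw [hlast] at h
      have hk' : (k : ℝ) ≠ 0 := by positivity
      have : (k : ℝ) * e 0 = 0 := by
        linear_combination h / 2 + ((k + 1 : ℝ) / 2) * h10
      exact (mul_eq_zero.1 this).resolve_left hk'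
    have h := (haff t ht.le).2
    rw [show e 1 = 0 by linarith, h0, he] at h
    push_cast at h
    rw [show 2 * ((t : ℝ) + 1) - 1 = 2 * t + 1 by ring] at h
    linarith

/-! ### The polynomials of the expansion -/

theorem PantsDecomposition.verlindeNumber_eq_verlindeSum {n : ℕ} (D : PantsDecomposition (n + 1))
    {k ℓ : ℕ} (hℓ : ℓ ∈ Finset.Icc 1 (k - 1)) :
    (verlindeNumber D k ℓ : ℝ) = (k / 2) ^ n * verlindeSum n k ℓ := by
  have hk : 0 < k := by
    rw [Finset.mem_Icc] at hℓ
    omega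
  rw [D.verlindeNumber_eq_sum hℓ, verlindeSum, Finset.mul_sum]
  refine Finset.sum_congr rfl fun j hj => ?_
  have hs := (sin_pi_mul_div_pos hj).ne'
  have hsq : √(2 / (k : ℝ)) ^ 2 = 2 / k := Real.sq_sqrt (by positivity)
  have hpos : √(2 / (k : ℝ)) ≠ 0 := by positivity
  have hk2 : (k / 2 : ℝ) ^ n = (√(2 / (k : ℝ)) ^ (2 * n))⁻¹ := by
    rw [pow_mul, hsq, ← inv_pow, inv_div]
  rw [hk2, show 2 * (n + 1) - 1 = 2 * n + 1 by omega]
  simp only [sMatrix, Nat.cast_one, mul_one]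
  rw [inv_pow, mul_pow, pow_succ √(2 / (k : ℝ))]
  field_simp

theorem bernoulli_natDegree (n : ℕ) : (Polynomial.bernoulli n).natDegree = n := by
  refine le_antisymm (Polynomial.natDegree_le_iff_coeff_eq_zero.2 fun i hi => ?_)
    (Polynomial.le_natDegree_of_ne_zero ?_)
  · rw [Polynomial.coeff_bernoulli, if_neg (by omega)]
  · simp [Polynomial.coeff_bernoulli]

/-- The coefficient polynomial of order `k^(-2m)` in genus `n + 1`, where `m ≤ n` (beyond this
the subtraction truncates, and the value is meaningless). -/
noncomputable def genusPoly (n m : ℕ) : Polynomial ℝ :=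
  Polynomial.C (-((2 * Real.pi) ^ (3 * n + 1) / 2 ^ n * (centralFactorial n).coeff (n - m)
      * 2 ^ (2 * (n - m) + 1) / (2 * (n - m : ℕ) + 1))) *
    ((Polynomial.bernoulli (2 * (n - m) + 1)).map (algebraMap ℚ ℝ)).comp
      (Polynomial.C (2⁻¹ : ℝ) * Polynomial.X)

theorem genusPoly_eval (n m : ℕ) (x : ℝ) :
    (genusPoly n m).eval x = -((2 * Real.pi) ^ (3 * n + 1) / 2 ^ n
      * (centralFactorial n).coeff (n - m) * 2 ^ (2 * (n - m) + 1) / (2 * (n - m : ℕ) + 1))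
        * bernoulliFun (2 * (n - m) + 1) (x / 2) := by
  rw [genusPoly, Polynomial.eval_mul, Polynomial.eval_C, Polynomial.eval_comp, bernoulliFun,
    Polynomial.eval_mul, Polynomial.eval_C, Polynomial.eval_X, inv_mul_eq_div]

theorem genusPoly_degree (n m : ℕ) :
    (genusPoly n m).degree = ((2 * (n - m) + 1 : ℕ) : WithBot ℕ) := by
  have hc : (-((2 * Real.pi) ^ (3 * n + 1) / 2 ^ n * (centralFactorial n).coeff (n - m)
      * 2 ^ (2 * (n - m) + 1) / (2 * (n - m : ℕ) + 1))) ≠ 0 := by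
    have h1 := centralFactorial_coeff_ne_zero (Nat.sub_le n m)
    have h2 := Real.pi_pos
    have h3 : (2 * ((n - m : ℕ) : ℝ) + 1) ≠ 0 := by positivity
    rw [neg_ne_zero]
    positivity
  rw [genusPoly, Polynomial.degree_C_mul hc,
    Polynomial.degree_eq_iff_natDegree_eq_of_pos (by omega), Polynomial.natDegree_comp,
    Polynomial.natDegree_map, bernoulli_natDegree,
    Polynomial.natDegree_C_mul_X _ (by norm_num), mul_one]

theorem evenPart_genusPoly (n m : ℕ) :
    evenPart (genusPoly n m) =
      Polynomial.C ((2 * Real.pi) ^ (3 * n + 1) / 2 ^ n * (centralFactorial n).coeff (n - m))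
        * Polynomial.X ^ (2 * (n - m)) := by
  refine Polynomial.funext fun x => ?_
  have hneg : bernoulliFun (2 * (n - m) + 1) (-(x / 2)) = -(bernoulliFun (2 * (n - m) + 1) (x / 2)
      + (2 * (n - m : ℕ) + 1) * (x / 2) ^ (2 * (n - m))) := by
    have h1 := bernoulliFun_one_add (2 * (n - m) + 1) (-(x / 2))
    rw [← sub_eq_add_neg, bernoulliFun_eval_one_sub, (odd_two_mul_add_one _).neg_one_pow,
      Nat.add_sub_cancel, (even_two_mul (n - m)).neg_pow] at h1
    push_cast at h1 ⊢
    linarith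
  have h3 : (2 * ((n - m : ℕ) : ℝ) + 1) ≠ 0 := by positivity
  simp only [evenPart, Polynomial.eval_mul, Polynomial.eval_C, Polynomial.eval_add,
    Polynomial.eval_comp, Polynomial.eval_neg, Polynomial.eval_X, Polynomial.eval_pow,
    genusPoly_eval]
  rw [neg_div, hneg, div_pow, pow_succ]
  field_simp
  ring

theorem verlindePoly_eval_eq_sum_genusPoly (n : ℕ) {k : ℕ} (hk : 0 < k) (x : ℝ) :
    (k / 2 : ℝ) ^ n * (verlindePoly n k).eval x
      = ((k : ℝ) / (2 * Real.pi)) ^ (3 * n + 1) *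
        ∑ m ∈ Finset.range (n + 1), (k : ℝ) ^ (-(2 * m : ℤ)) * (genusPoly n m).eval (x / k) := by
  have hk' : (k : ℝ) ≠ 0 := by positivity
  rw [verlindePoly_eval, ← Finset.sum_neg_distrib,
    ← Finset.sum_range_reflect _ (n + 1), Finset.mul_sum, Finset.mul_sum]
  refine Finset.sum_congr rfl fun m hm => ?_
  have hm' : m ≤ n := by
    rw [Finset.mem_range] at hm
    omega
  rw [genusPoly_eval, show n + 1 - 1 - m = n - m by omega, div_div, mul_comm (k : ℝ) 2]
  have hpow : (k : ℝ) ^ (3 * n + 1) * (k : ℝ) ^ (-(2 * m : ℤ)) = k ^ n * k ^ (2 * (n - m) + 1) := by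
    rw [← pow_add, ← zpow_natCast, ← zpow_natCast, ← zpow_add₀ hk']
    congr 1
    push_cast [Nat.cast_sub hm']
    ring
  have h3 : (2 * ((n - m : ℕ) : ℝ) + 1) ≠ 0 := by positivity
  rw [div_pow, div_pow, mul_pow (2 : ℝ) (k : ℝ)]
  -- With the powers abstracted, the claim is `hpow` up to field operations.
  generalize bernoulliFun (2 * (n - m) + 1) (x / (2 * k)) = b
  generalize (k : ℝ) ^ (-(2 * m : ℤ)) = z at hpow ⊢
  generalize (2 * ((n - m : ℕ) : ℝ) + 1) = q at h3 ⊢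
  have h2pi : (2 * Real.pi) ^ (3 * n + 1) ≠ 0 := by positivity
  generalize (2 * Real.pi) ^ (3 * n + 1) = w at h2pi ⊢
  generalize (k : ℝ) ^ (3 * n + 1) = u at hpow ⊢
  generalize (k : ℝ) ^ (2 * (n - m) + 1) = v at hpow ⊢
  generalize (2 : ℝ) ^ (2 * (n - m) + 1) = p
  generalize (k : ℝ) ^ n = r at hpow ⊢
  field_simp
  linear_combination (-(p * b * (centralFactorial n).coeff (n - m))) * hpow.symm

theorem mainTheorem2 (g : ℕ) (hg : 1 ≤ g) :
    ∃ (P : ℕ → Polynomial ℝ) (lam : ℕ → ℝ),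
      (∀ (D : PantsDecomposition g) (k ℓ : ℕ), Odd ℓ → 1 ≤ ℓ → ℓ ≤ k - 1 →
        (verlindeNumber D k ℓ : ℝ) = ((k : ℝ) / (2 * Real.pi)) ^ (3 * g - 2) *
          ∑ m ∈ Finset.range g, (k : ℝ) ^ (-(2 * m : ℤ)) * (P m).eval ((ℓ : ℝ) / (k : ℝ))) ∧
      (∀ m < g, (P m).degree = ((2 * (g - m) - 1 : ℕ) : WithBot ℕ)) ∧
      (∀ m < g, evenPart (P m) = Polynomial.C (lam m) * Polynomial.X ^ (2 * (g - m - 1))) ∧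
      lam 0 = 2 * verlindeConst g * (2 * Real.pi) ^ (3 * g - 2) /
        (Nat.factorial (2 * (g - 1)) : ℝ) := by
  obtain ⟨n, rfl⟩ : ∃ n, g = n + 1 := ⟨g - 1, by omega⟩
  have hexp : 3 * (n + 1) - 2 = 3 * n + 1 := by omega
  refine ⟨genusPoly n, fun m =>
    (2 * Real.pi) ^ (3 * n + 1) / 2 ^ n * (centralFactorial n).coeff (n - m), ?_, ?_, ?_, ?_⟩
  · rintro D k ℓ ⟨t, rfl⟩ h1 h2
    have hsum := verlindeSum_eq_verlindePoly (k := k) n (t := t) (by omega)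
    have hℓ : ((2 * t + 1 : ℕ) : ℝ) = 2 * t + 1 := by push_cast; ring
    rw [D.verlindeNumber_eq_verlindeSum (Finset.mem_Icc.2 ⟨h1, h2⟩), hexp, hℓ, hsum,
      verlindePoly_eval_eq_sum_genusPoly n (by omega)]
  · intro m hm
    rw [genusPoly_degree, show 2 * (n + 1 - m) - 1 = 2 * (n - m) + 1 by omega]
  · intro m hm
    rw [evenPart_genusPoly, show n + 1 - m - 1 = n - m by omega]
  · simp only [tsub_zero]
    rw [hexp, centralFactorial_coeff_self, verlindeConst, Nat.add_sub_cancel, pow_succ]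
    field_simp
    ring
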